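/- Let $q$ be a power of a prime $p$, and let $e,k$ be positive integers with $q=ek+1$ and $k$ prime. Let $g$ be a primitive element of $\mathbb{F}_q$ (a generator of $\mathbb{F}_q^*$), and for $a\in\mathbb{Z}$ put $C_a=\{g^a,g^{a+e},\dots,g^{a+(k-1)e}\}$. For $a,b\in\mathbb{Z}$ let the cyclotomic number $(a,b)$ be the number of pairs $(x,y)\in C_a\times C_b$ with $1+x=y$. Let $\mathrm{ord}_k(p)$ denote the multiplicative order of $p$ modulo $k$. If $a,b\in\{1,\dots,e-1\}$, $a\neq b$, and $$p>\left(3^{k-1}k\right)^{1/\mathrm{ord}_k(p)},$$ then $(a,b)\le 2$. -/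

import Mathlib

/-- The cyclotomic class `C_a = {g^a, g^(a+e), …, g^(a+(k-1)e)}` in the field `F`,
for `g` a nonzero element of `F`. -/
def cyclotomicClass {F : Type*} [Field F] (g : Fˣ) (e k : ℕ) (a : ℤ) : Set F :=
  {x | ∃ r : ℕ, r < k ∧ x = ((g ^ (a + (r : ℤ) * (e : ℤ)) : Fˣ) : F)}

/-- The cyclotomic number `(a,b)`: the number of solutions of `1 + x = y`
with `x ∈ C_a` and `y ∈ C_b`. -/
noncomputable def cyclotomicNumber {F : Type*} [Field F] (g : Fˣ) (e k : ℕ) (a b : ℤ) : ℕ :=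
  Set.ncard {z : F × F |
    z.1 ∈ cyclotomicClass g e k a ∧ z.2 ∈ cyclotomicClass g e k b ∧ 1 + z.1 = z.2}

/-! Three solutions `1 + α φ(rᵢ) = β φ(sᵢ)`, with `φ` a character of `ZMod k` onto the `k`-th roots
of unity of `F`, make the determinant with rows `(1, φ rᵢ, φ sᵢ)` vanish: a relation among six roots
of unity with coefficients `±1`.

Relations with coefficient square sum at most 8 lift to characteristic zero
(`coeff_eq_of_sum_eq_zero_of_large_char`): a nonzero lift would have norm at least `p ^ ord_k(p)`,
while Parseval and AM-GM bound it by `3 ^ (k - 1) * k`. Since `k` is prime, a lifted relation has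
all coefficients equal.

If the three exponents on one side are distinct and those on the other not all equal, this matches
the exponents and gives `r₁ + s₂ = r₂ + s₁`, which forces `r₁ = r₂`. The remaining coincidences have
square sum above 8 before cancellation; there the relation factors into shorter ones. -/

/-! ### Lower bound for norms, from the finite field -/

open scoped NumberField in
/-- An algebraic integer of nonzero norm in the kernel of a map to a
finite field has norm at least the size of the image. -/
theorem card_range_le_natAbs_norm {K F : Type*} [Field K] [NumberField K] [Field F] [Finite F]
    (f : 𝓞 K →+* F) {x : 𝓞 K} (hx : x ≠ 0) (hfx : f x = 0) :
    Nat.card f.range ≤ (Algebra.norm ℤ x).natAbs := by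
  have h1 : Ideal.absNorm (RingHom.ker f) = Nat.card f.range := by
    rw [Ideal.absNorm_apply, Submodule.cardQuot_apply]
    exact Nat.card_congr f.quotientKerEquivRange.toEquiv
  have h2 : Ideal.span {x} ≤ RingHom.ker f := by
    rw [Ideal.span_singleton_le_iff_mem]; exact hfx
  rw [← h1, ← Ideal.absNorm_span_singleton]
  refine Nat.le_of_dvd ?_ (Ideal.absNorm_dvd_absNorm_of_le h2)
  rw [Ideal.absNorm_span_singleton, Int.natAbs_pos, Algebra.norm_ne_zero_iff]
  exact hx

/-- A subring of a finite field of characteristic `p` containing an element of order `k` has at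
least `p ^ ord_k(p)` elements. -/
theorem pow_orderOf_le_card_subring {F : Type*} [Field F] [Finite F] {p k : ℕ} [CharP F p]
    [NeZero k] (hp : p.Prime) (A : Subring F) {h : F} (hA : h ∈ A) (hh : orderOf h = k) :
    p ^ orderOf (p : ZMod k) ≤ Nat.card A := by
  have : Fact p.Prime := ⟨hp⟩
  cases nonempty_fintype F
  have : Fintype A := Fintype.ofFinite A
  classical
  let _ : Field A := Fintype.fieldOfDomain A
  have : CharP A p := (A.subtype.charP_iff Subtype.val_injective p).2 inferInstance
  obtain ⟨m, -, hm⟩ := FiniteField.card A p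
  rw [Nat.card_eq_fintype_card, hm]
  have hh0 : h ≠ 0 := by
    rintro rfl
    have h1 : (0 : F) ^ k = 1 := hh ▸ pow_orderOf_eq_one _
    simp [NeZero.ne k] at h1
  have h2 : (⟨h, hA⟩ : A) ^ (Fintype.card A - 1) = 1 :=
    FiniteField.pow_card_sub_one_eq_one _ (by simpa [Subtype.ext_iff] using hh0)
  have h3 : k ∣ p ^ (m : ℕ) - 1 := by
    rw [← hh, ← hm]
    apply orderOf_dvd_of_pow_eq_one
    simpa [Subtype.ext_iff] using h2
  have h4 : (p : ZMod k) ^ (m : ℕ) = 1 := by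
    have := (ZMod.natCast_eq_zero_iff (p ^ (m : ℕ) - 1) k).2 h3
    rw [Nat.cast_sub (Nat.one_le_pow _ _ hp.pos), sub_eq_zero] at this
    simpa using this
  exact Nat.pow_le_pow_right hp.pos (orderOf_le_of_pow_eq_one m.pos h4)

/-! ### Upper bound for norms, from Parseval and AM-GM -/

/-- Parseval's identity on `ZMod k` for integer-valued functions. -/
theorem ZMod.sum_norm_sq_stdAddChar {k : ℕ} [NeZero k] (c : ZMod k → ℤ) :
    ∑ j : ZMod k, ‖∑ i : ZMod k, (c i : ℂ) * ZMod.stdAddChar (j * i)‖ ^ 2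
      = k * ∑ i, (c i : ℝ) ^ 2 := by
  have key : ∑ j : ZMod k, ((‖∑ i : ZMod k, (c i : ℂ) * ZMod.stdAddChar (j * i)‖ : ℂ)) ^ 2
      = k * ∑ i, (c i : ℂ) ^ 2 := by
    have h1 (j : ZMod k) : ((‖∑ i : ZMod k, (c i : ℂ) * ZMod.stdAddChar (j * i)‖ : ℂ)) ^ 2
        = ∑ i, ∑ i', (c i : ℂ) * c i' * ZMod.stdAddChar (j * (i - i')) := by
      rw [← Complex.mul_conj', map_sum, Finset.sum_mul_sum]
      refine Finset.sum_congr rfl fun i _ => Finset.sum_congr rfl fun i' _ => ?_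
      rw [mul_sub, sub_eq_add_neg, AddChar.map_add_eq_mul, map_mul (starRingEnd ℂ),
        AddChar.map_neg_eq_conj]
      rw [map_intCast (starRingEnd ℂ)]
      ring
    simp_rw [h1]
    rw [Finset.sum_comm, Finset.mul_sum]
    refine Finset.sum_congr rfl fun i _ => ?_
    rw [Finset.sum_comm]
    simp_rw [← Finset.mul_sum, AddChar.sum_mulShift _ (ZMod.isPrimitive_stdAddChar k)]
    simp [sub_eq_zero, ZMod.card]
    ring
  exact_mod_cast key

/-- The arithmetic-geometric mean inequality without roots. -/
theorem Finset.prod_le_sum_div_card_pow {ι : Type*} (s : Finset ι) (hs : s.Nonempty) (z : ι → ℝ)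
    (hz : ∀ i ∈ s, 0 ≤ z i) : ∏ i ∈ s, z i ≤ ((∑ i ∈ s, z i) / s.card) ^ s.card := by
  have hc : (0 : ℝ) < s.card := by exact_mod_cast hs.card_pos
  have h := Real.geom_mean_le_arith_mean s (fun _ => 1) z (by simp) (by simpa using hs) hz
  simp only [Real.rpow_one, one_mul, Finset.sum_const, nsmul_eq_mul, mul_one] at h
  have hP : 0 ≤ ∏ i ∈ s, z i := Finset.prod_nonneg hz
  calc ∏ i ∈ s, z i = ((∏ i ∈ s, z i) ^ ((s.card : ℝ)⁻¹)) ^ s.card := by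
        rw [Real.rpow_inv_natCast_pow hP hs.card_pos.ne']
    _ ≤ _ := pow_le_pow_left₀ (by positivity) h _

open scoped NumberField in
/-- Bound for the norm of a cyclotomic integer in terms of its coefficients. -/
theorem sq_norm_cyclotomic_le {K : Type*} [Field K] [NumberField K] {k : ℕ} [NeZero k]
    (hk : k.Prime) [IsCyclotomicExtension {k} ℚ K] {ζ : K} (hζ : IsPrimitiveRoot ζ k)
    (c : ZMod k → ℤ) :
    ((Algebra.norm ℤ (∑ i : ZMod k, (c i : 𝓞 K) * hζ.toInteger ^ i.val) : ℤ) : ℝ) ^ 2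
      ≤ ((k * ∑ i, (c i : ℝ) ^ 2) / (k - 1 : ℕ)) ^ (k - 1) := by
  classical
  set x : 𝓞 K := ∑ i : ZMod k, (c i : 𝓞 K) * hζ.toInteger ^ i.val
  have hirr := Polynomial.cyclotomic.irreducible_rat hk.pos
  have hcard : Fintype.card (K →ₐ[ℚ] ℂ) = k - 1 := by
    rw [AlgHom.card, IsCyclotomicExtension.finrank K hirr, Nat.totient_prime hk]
  have hω : IsPrimitiveRoot (ZMod.stdAddChar (1 : ZMod k)) k := by
    have := Complex.isPrimitiveRoot_exp k (NeZero.ne k)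
    have h2 := ZMod.stdAddChar_coe (N := k) 1
    simp only [Int.cast_one, mul_one] at h2
    rwa [h2]
  have hex (σ : K →ₐ[ℚ] ℂ) : ∃ j : ZMod k, σ ζ = ZMod.stdAddChar j := by
    have h1 : (σ ζ) ^ k = 1 := by rw [← map_pow, hζ.pow_eq_one, map_one]
    obtain ⟨i, -, hi⟩ := hω.eq_pow_of_pow_eq_one h1
    exact ⟨i, by rw [← hi, ← AddChar.map_nsmul_eq_pow, nsmul_one]⟩
  choose J hJ using hex
  have hJinj : Function.Injective J := by
    intro σ τ h
    apply (hζ.powerBasis ℚ).algHom_ext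
    simp [hJ, h]
  have hval (σ : K →ₐ[ℚ] ℂ) :
      σ (x : K) = ∑ i : ZMod k, (c i : ℂ) * ZMod.stdAddChar (J σ * i) := by
    simp only [x, map_sum, map_mul, map_pow, map_intCast]
    refine Finset.sum_congr rfl fun i _ => ?_
    congr 1
    change σ ζ ^ i.val = _
    rw [hJ, ← AddChar.map_nsmul_eq_pow, nsmul_eq_mul, ZMod.natCast_zmod_val, mul_comm]
  have hnorm : ((Algebra.norm ℤ x : ℤ) : ℂ) = ∏ σ : K →ₐ[ℚ] ℂ, σ (x : K) := by
    rw [← Algebra.norm_eq_prod_embeddings ℚ ℂ (x : K), ← Algebra.coe_norm_int]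
    simp
  have hnorm2 : ((Algebra.norm ℤ x : ℤ) : ℝ) ^ 2 = ∏ σ : K →ₐ[ℚ] ℂ, ‖σ (x : K)‖ ^ 2 := by
    rw [Finset.prod_pow, ← norm_prod, ← hnorm, Complex.norm_intCast, sq_abs]
  rw [hnorm2]
  have hne : (Finset.univ : Finset (K →ₐ[ℚ] ℂ)).Nonempty := by
    rw [← Finset.card_pos, Finset.card_univ, hcard]
    have := hk.two_le
    omega
  refine (Finset.prod_le_sum_div_card_pow _ hne _ fun _ _ => by positivity).trans ?_
  rw [Finset.card_univ, hcard]
  refine pow_le_pow_left₀ (by positivity) ?_ _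
  refine div_le_div_of_nonneg_right ?_ (by positivity)
  rw [← ZMod.sum_norm_sq_stdAddChar]
  simp_rw [hval]
  rw [← Finset.sum_image (f := fun j => ‖∑ i : ZMod k, (c i : ℂ) * ZMod.stdAddChar (j * i)‖ ^ 2)
    (s := Finset.univ) (g := J) hJinj.injOn]
  -- The embeddings correspond to distinct frequencies `j`; the frequencies they miss only add
  -- nonnegative terms.
  exact Finset.sum_le_sum_of_subset_of_nonneg (Finset.subset_univ _) fun _ _ _ => by positivity

/-! ### Lifting short relations to characteristic zero -/

/-- A vanishing rational relation among the `k`-th roots of unity, `k` prime, is trivial. -/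
theorem IsPrimitiveRoot.coeff_eq_of_sum_eq_zero {K : Type*} [Field K] [CharZero K] {k : ℕ}
    [NeZero k] (hk : k.Prime) {ζ : K} (hζ : IsPrimitiveRoot ζ k) (c : ZMod k → ℤ)
    (h : ∑ i : ZMod k, (c i : K) * ζ ^ i.val = 0) (i j : ZMod k) : c i = c j := by
  classical
  open Polynomial in
  have : Fact k.Prime := ⟨hk⟩
  set P : ℚ[X] := ∑ i : ZMod k, C (c i : ℚ) * X ^ i.val with hP
  have hcoef (i : ZMod k) : P.coeff i.val = c i := by
    simp [hP, coeff_X_pow, (ZMod.val_injective k).eq_iff]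
  have hdeg : P.natDegree ≤ k - 1 := by
    refine natDegree_sum_le_of_forall_le _ _ fun i _ => (natDegree_C_mul_X_pow_le _ _).trans ?_
    have := ZMod.val_lt i
    omega
  have hdvd : cyclotomic k ℚ ∣ P := by
    rw [cyclotomic_eq_minpoly_rat hζ hk.pos]
    apply minpoly.dvd
    simpa [hP, map_sum] using h
  obtain ⟨Q, hQ⟩ := hdvd
  have hcyc : (cyclotomic k ℚ).natDegree = k - 1 := by
    rw [natDegree_cyclotomic, Nat.totient_prime hk]
  have hQ0 : Q.natDegree = 0 := by
    by_cases hQz : Q = 0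
    · simp [hQz]
    · have := natDegree_mul (cyclotomic_ne_zero k ℚ) hQz
      rw [← hQ, hcyc] at this
      omega
  obtain ⟨a, rfl⟩ := natDegree_eq_zero.1 hQ0
  -- By degree, `P` is a scalar multiple of `1 + X + ⋯ + X ^ (k - 1)`.
  have hall (i : ZMod k) : (c i : ℚ) = a := by
    rw [← hcoef, hQ, coeff_mul_C, cyclotomic_prime]
    simp [coeff_X_pow, ZMod.val_lt]
  exact_mod_cast (hall i).trans (hall j).symm

/-- Bounding `S` by 9 leaves the factor `(1 + 1 / (k - 1)) ^ (k - 1) < e < 4`, and `4 ≤ k ^ 2`. -/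
theorem mul_div_pow_le_sq {k : ℕ} (hk : 2 ≤ k) {S : ℝ} (hS0 : 0 ≤ S) (hS : S ≤ 8) :
    (k * S / (k - 1 : ℕ)) ^ (k - 1) ≤ ((3 : ℝ) ^ (k - 1) * k) ^ 2 := by
  obtain ⟨m, rfl⟩ : ∃ m, k = m + 2 := ⟨k - 2, by omega⟩
  have hm : ((m + 2 - 1 : ℕ) : ℝ) = m + 1 := by norm_num
  rw [hm, show m + 2 - 1 = m + 1 by omega]
  have hE : (1 + 1 / ((m : ℝ) + 1)) ^ (m + 1) ≤ 4 := by
    have h6 : (1 + 1 / ((m : ℝ) + 1)) ^ (m + 1) ≤ Real.exp (1 / ((m : ℝ) + 1)) ^ (m + 1) := by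
      refine pow_le_pow_left₀ (by positivity) ?_ _
      rw [add_comm]
      exact Real.add_one_le_exp _
    rw [← Real.exp_nat_mul] at h6
    have h7 : ((m + 1 : ℕ) : ℝ) * (1 / ((m : ℝ) + 1)) = 1 := by
      push_cast
      field_simp
    rw [h7] at h6
    linarith [Real.exp_one_lt_d9]
  calc _ ≤ (9 * (1 + 1 / ((m : ℝ) + 1))) ^ (m + 1) := by
        refine pow_le_pow_left₀ (by positivity) ?_ _
        rw [div_le_iff₀ (by positivity)]
        push_cast
        field_simp
        nlinarith [(Nat.cast_nonneg m : (0 : ℝ) ≤ m)]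
    _ = 9 ^ (m + 1) * (1 + 1 / ((m : ℝ) + 1)) ^ (m + 1) := mul_pow _ _ _
    _ ≤ 9 ^ (m + 1) * 4 := by gcongr
    _ ≤ _ := by
        rw [mul_pow, ← pow_mul, mul_comm (m + 1) 2, pow_mul]
        push_cast
        norm_num
        nlinarith [(Nat.cast_nonneg m : (0 : ℝ) ≤ m)]

/-- If `c` has small coefficients and `∑ c i h ^ i` vanishes in characteristic `p`, with `p` large,
then it vanishes for trivial reasons. -/
theorem coeff_eq_of_sum_eq_zero_of_large_char {F : Type*} [Field F] [Finite F] {p k : ℕ} [CharP F p]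
    [NeZero k] (hp : p.Prime) (hk : k.Prime) {h : F} (hh : orderOf h = k)
    (hbound : 3 ^ (k - 1) * k < p ^ orderOf (p : ZMod k))
    (c : ZMod k → ℤ) (hc : ∑ i, c i ^ 2 ≤ 8) (h0 : ∑ i : ZMod k, (c i : F) * h ^ i.val = 0)
    (i j : ZMod k) : c i = c j := by
  let K := CyclotomicField k ℚ
  have : IsCyclotomicExtension {k} ℚ K := CyclotomicField.isCyclotomicExtension k ℚ
  have : NumberField K := IsCyclotomicExtension.numberField {k} ℚ K
  have hζ := IsCyclotomicExtension.zeta_spec k ℚ K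
  set x : NumberField.RingOfIntegers K :=
    ∑ i : ZMod k, (c i : NumberField.RingOfIntegers K) * hζ.toInteger ^ i.val with hx
  by_cases hx0 : x = 0
  · apply hζ.coeff_eq_of_sum_eq_zero hk c
    have := congrArg (algebraMap (NumberField.RingOfIntegers K) K) hx0
    simp only [hx, map_sum, map_mul, map_pow, map_intCast, map_zero] at this
    exact this
  exfalso
  have hprim : IsPrimitiveRoot h k := hh ▸ IsPrimitiveRoot.orderOf h
  have hroot : Polynomial.aeval h (minpoly ℤ hζ.integralPowerBasis.gen) = 0 := by
    rw [hζ.integralPowerBasis_gen]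
    have h1 : minpoly ℤ hζ.toInteger = Polynomial.cyclotomic k ℤ :=
      (minpoly.algebraMap_eq (NumberField.RingOfIntegers.coe_injective (K := K))
        hζ.toInteger).symm.trans (Polynomial.cyclotomic_eq_minpoly hζ hk.pos).symm
    rw [h1, Polynomial.aeval_def, Polynomial.eval₂_eq_eval_map, Polynomial.map_cyclotomic]
    exact hprim.isRoot_cyclotomic hk.pos
  set f := (hζ.integralPowerBasis.lift h hroot).toRingHom with hf
  have hfg : f hζ.toInteger = h := by
    have := hζ.integralPowerBasis.lift_gen h hroot
    rwa [hζ.integralPowerBasis_gen] at this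
  have hfx : f x = 0 := by
    simp only [hx, map_sum, map_mul, map_pow, map_intCast, hfg, h0]
  have h1 := pow_orderOf_le_card_subring hp f.range ⟨_, hfg⟩ hh
  have h2 := card_range_le_natAbs_norm f hx0 hfx
  have h3 : 3 ^ (k - 1) * k < (Algebra.norm ℤ x).natAbs := hbound.trans_le (h1.trans h2)
  have h4 := sq_norm_cyclotomic_le hk hζ c
  have h5 : ((3 : ℝ) ^ (k - 1) * k) ^ 2 < ((Algebra.norm ℤ x : ℤ) : ℝ) ^ 2 := by
    rw [← sq_abs ((Algebra.norm ℤ x : ℤ) : ℝ), ← Int.cast_abs, ← Int.natCast_natAbs]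
    refine pow_lt_pow_left₀ ?_ (by positivity) two_ne_zero
    exact_mod_cast h3
  refine absurd (h5.trans_le h4) (not_lt.2 ?_)
  have hc' : ∑ i, (c i : ℝ) ^ 2 ≤ 8 := by exact_mod_cast hc
  exact mul_div_pow_le_sq hk.two_le (Finset.sum_nonneg fun _ _ => sq_nonneg _) hc'

/-! ### Short relations among the values of a rigid character -/

/-- No short integer relation between the values of `φ` other than multiples of `∑ φ i = 0`. -/
def AddChar.IsRigid {F : Type*} [Field F] {k : ℕ} [NeZero k] (φ : AddChar (ZMod k) F) : Prop :=
  ∀ c : ZMod k → ℤ, ∑ i, c i ^ 2 ≤ 8 → ∑ i, (c i : F) * φ i = 0 → ∀ i j, c i = c j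

theorem ZMod.eq_of_ne_three : ∀ a b c : ZMod 3, a ≠ b → a ≠ c → b ≠ c →
    c = a + ((b - a) + (b - a)) := by
  decide

theorem ZMod.not_distinct_two : ∀ a b c : ZMod 2, a ≠ b → a ≠ c → b ≠ c → False := by
  decide

namespace AddChar.IsRigid

variable {F : Type*} [Field F] {k : ℕ} [NeZero k] {φ : AddChar (ZMod k) F}

/-- The coefficients are constant with total 0, hence all zero, yet the one at `a` is 1 or 2. -/
theorem not_two_mul_eq_add (hφ : φ.IsRigid) {a b c : ZMod k} (h : 2 * φ a = φ b + φ c)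
    (hab : a ≠ b) : False := by
  let C : ZMod k → ℤ := fun i => 2 * (if i = a then 1 else 0) - (if i = b then 1 else 0)
    - (if i = c then 1 else 0)
  have hs (f : ZMod k → ℤ) : ∑ i, C i * f i = 2 * f a - f b - f c := by
    simp [C, sub_mul, Finset.sum_sub_distrib]
  have hsF (f : ZMod k → F) : ∑ i, (C i : F) * f i = 2 * f a - f b - f c := by
    simp [C, sub_mul, Finset.sum_sub_distrib]
  have hsq : ∑ i, C i ^ 2 ≤ 8 := by
    -- Pairing `C` with itself computes its square sum.
    have := hs C
    simp only [← sq] at this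
    rw [this]
    simp only [C]
    have hba := hab.symm
    simp only [if_true, if_neg hab, if_neg hba]
    split_ifs <;> norm_num
  have hc := hφ C hsq (by rw [hsF, h]; ring)
  have h1 := hs fun _ => 1
  simp only [mul_one, hc _ a, Finset.sum_const, Finset.card_univ, ZMod.card,
    nsmul_eq_mul] at h1
  have h2 : C a = 0 := by
    simpa [NeZero.ne k] using h1
  simp only [C, if_neg hab] at h2
  split_ifs at h2 <;> omega

/-- Constant coefficients, one of them equal to 1, have total `k`; here the total is 3. -/
theorem not_sum_three_eq_zero (hφ : φ.IsRigid) (hk3 : k ≠ 3) {x y z : ZMod k}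
    (hxy : x ≠ y) (hxz : x ≠ z) (hyz : y ≠ z) (h : φ x + φ y + φ z = 0) : False := by
  let C : ZMod k → ℤ := fun i => (if i = x then 1 else 0) + (if i = y then 1 else 0)
    + (if i = z then 1 else 0)
  have hs (f : ZMod k → ℤ) : ∑ i, C i * f i = f x + f y + f z := by
    simp [C, add_mul, Finset.sum_add_distrib]
  have hsF (f : ZMod k → F) : ∑ i, (C i : F) * f i = f x + f y + f z := by
    simp [C, add_mul, Finset.sum_add_distrib]
  have hsq : ∑ i, C i ^ 2 ≤ 8 := by
    have := hs C
    simp only [← sq] at this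
    rw [this]
    simp [C, hxy, hxz, hyz, hxy.symm, hxz.symm, hyz.symm]
  have hc := hφ C hsq (by rw [hsF, h])
  have h1 := hs fun _ => 1
  simp only [mul_one, hc _ x, Finset.sum_const, Finset.card_univ, ZMod.card,
    nsmul_eq_mul] at h1
  have h2 : C x = 1 := by simp [C, hxy, hxz]
  rw [h2] at h1
  exact hk3 (by exact_mod_cast (mul_one (k : ℤ)).symm.trans h1)

/-- At most one coincidence among the `pᵢ` and none among the `mᵢ` gives square sum at most `(4 + 1)
+ 3 = 8`. The coefficients have total 0, so they vanish and each `pᵢ` must be cancelled by some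
`mⱼ`. -/
theorem mem_of_sum_three_eq (hφ : φ.IsRigid) {p₁ p₂ p₃ m₁ m₂ m₃ : ZMod k}
    (h : φ p₁ + φ p₂ + φ p₃ = φ m₁ + φ m₂ + φ m₃) (hp : ¬(p₁ = p₂ ∧ p₁ = p₃))
    (h12 : m₁ ≠ m₂) (h13 : m₁ ≠ m₃) (h23 : m₂ ≠ m₃) :
    (p₁ = m₁ ∨ p₁ = m₂ ∨ p₁ = m₃) ∧ (p₂ = m₁ ∨ p₂ = m₂ ∨ p₂ = m₃) ∧
      (p₃ = m₁ ∨ p₃ = m₂ ∨ p₃ = m₃) := by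
  let δ : ZMod k → ZMod k → ℤ := fun u v => if u = v then 1 else 0
  let C : ZMod k → ℤ := fun i => δ i p₁ + δ i p₂ + δ i p₃ - δ i m₁ - δ i m₂ - δ i m₃
  have hδ0 (u v) : 0 ≤ δ u v := by simp only [δ]; split_ifs <;> simp
  have hδs (u v) : δ u v = δ v u := by simp only [δ, eq_comm]
  have hδ1 (u) : δ u u = 1 := by simp [δ]
  have hδn {u v} (h : u ≠ v) : δ u v = 0 := by simp [δ, h]
  have hs (f : ZMod k → ℤ) : ∑ i, C i * f i = f p₁ + f p₂ + f p₃ - f m₁ - f m₂ - f m₃ := by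
    simp [C, δ, sub_mul, add_mul, Finset.sum_sub_distrib, Finset.sum_add_distrib]
  have hsF (f : ZMod k → F) : ∑ i, (C i : F) * f i = f p₁ + f p₂ + f p₃ - f m₁ - f m₂ - f m₃ := by
    simp [C, δ, sub_mul, add_mul, Finset.sum_sub_distrib, Finset.sum_add_distrib]
  have hpp : δ p₁ p₂ + δ p₁ p₃ + δ p₂ p₃ ≤ 1 := by
    simp only [δ]; split_ifs <;> simp_all
  have hsq : ∑ i, C i ^ 2 ≤ 8 := by
    have := hs C
    simp only [← sq] at this
    rw [this]
    simp only [C, hδ1, hδn h12, hδn h13, hδn h23, hδn h12.symm, hδn h13.symm, hδn h23.symm,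
      hδs p₂ p₁, hδs p₃ p₁, hδs p₃ p₂, hδs m₁, hδs m₂, hδs m₃]
    linarith [hδ0 p₁ m₁, hδ0 p₁ m₂, hδ0 p₁ m₃, hδ0 p₂ m₁, hδ0 p₂ m₂, hδ0 p₂ m₃, hδ0 p₃ m₁,
      hδ0 p₃ m₂, hδ0 p₃ m₃]
  have hc := hφ C hsq (by rw [hsF, h]; ring)
  have hC0 (u) : C u = 0 := by
    have h1 := hs fun _ => 1
    simp only [mul_one, hc _ u, Finset.sum_const, Finset.card_univ, ZMod.card,
      nsmul_eq_mul] at h1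
    simpa [NeZero.ne k] using h1
  refine ⟨?_, ?_, ?_⟩ <;> by_contra! hn
  · have := hC0 p₁
    simp only [C, hδ1, hδn hn.1, hδn hn.2.1, hδn hn.2.2] at this
    linarith [hδ0 p₁ p₂, hδ0 p₁ p₃]
  · have := hC0 p₂
    simp only [C, hδ1, hδn hn.1, hδn hn.2.1, hδn hn.2.2] at this
    linarith [hδ0 p₂ p₁, hδ0 p₂ p₃]
  · have := hC0 p₃
    simp only [C, hδ1, hδn hn.1, hδn hn.2.1, hδn hn.2.2] at this
    linarith [hδ0 p₃ p₁, hδ0 p₃ p₂]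

/-- A value of `φ` is not the average of three distinct values with the same product. -/
theorem not_three_mul_eq (hφ : φ.IsRigid) (hk : k.Prime) (hkF : (k : F) ≠ 0)
    {P m₁ m₂ m₃ : ZMod k} (h12 : m₁ ≠ m₂) (h13 : m₁ ≠ m₃) (h23 : m₂ ≠ m₃)
    (hsum : m₁ + m₂ + m₃ = 3 * P) (h : 3 * φ P = φ m₁ + φ m₂ + φ m₃) : False := by
  have : Fact k.Prime := ⟨hk⟩
  by_cases hk3 : k = 3
  · subst hk3
    -- For `k = 3` the `mᵢ` exhaust `ZMod 3`, so the right side is a sum of all cube roots of unity.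
    have hm : ∃ v : ZMod 3, v ≠ 0 ∧ φ m₁ + φ m₂ + φ m₃ = φ m₁ * (1 + φ v + φ (v + v)) := by
      refine ⟨m₂ - m₁, sub_ne_zero.2 h12.symm, ?_⟩
      have h3 : m₃ = m₁ + ((m₂ - m₁) + (m₂ - m₁)) := ZMod.eq_of_ne_three m₁ m₂ m₃ h12 h13 h23
      rw [h3]
      have h2 : φ m₂ = φ m₁ * φ (m₂ - m₁) := by
        rw [← AddChar.map_add_eq_mul]; congr 1; ring
      rw [AddChar.map_add_eq_mul φ m₁, h2]; ring
    obtain ⟨v, hv, hm⟩ := hm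
    have hv3 : φ v ^ 3 = 1 := by
      rw [← AddChar.map_nsmul_eq_pow]
      have : (3 : ℕ) • v = 0 := by rw [nsmul_eq_mul, ZMod.natCast_self, zero_mul]
      rw [this, AddChar.map_zero_eq_one]
    have hprod : (φ v - 1) * (1 + φ v + φ (v + v)) = 0 := by
      rw [AddChar.map_add_eq_mul]
      linear_combination hv3
    rcases mul_eq_zero.1 hprod with h1 | h1
    · exact hφ.not_two_mul_eq_add (a := 0) (b := v) (c := v)
        (by rw [AddChar.map_zero_eq_one]; linear_combination (-2) * h1) hv.symm
    · rw [hm, h1, mul_zero] at h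
      have : (3 : F) = 0 := by
        rcases mul_eq_zero.1 h with h' | h'
        · exact h'
        · exact absurd h' ((φ.val_isUnit P).ne_zero)
      exact hkF (by exact_mod_cast this)
  · have h3 : (3 : ZMod k) ≠ 0 := by
      intro h0
      have : ((3 : ℕ) : ZMod k) = 0 := by exact_mod_cast h0
      rw [ZMod.natCast_eq_zero_iff, Nat.prime_dvd_prime_iff_eq hk Nat.prime_three] at this
      exact hk3 this
    -- Extracting cube roots turns the relation into `X³ + Y³ + Z³ = 3XYZ` with `XYZ = 1`, which
    -- factors as `(X + Y + Z)(X² + Y² + Z² - YZ - XZ - XY) = 0`.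
    obtain ⟨x, hx⟩ : ∃ x, m₁ = P + (x + x + x) := ⟨(m₁ - P) / 3, by field_simp; ring⟩
    obtain ⟨y, hy⟩ : ∃ y, m₂ = P + (y + y + y) := ⟨(m₂ - P) / 3, by field_simp; ring⟩
    obtain ⟨z, hz⟩ : ∃ z, m₃ = P + (z + z + z) := ⟨(m₃ - P) / 3, by field_simp; ring⟩
    subst hx hy hz
    have hxyz : x + y + z = 0 := by
      refine (mul_eq_zero.1 (?_ : (3 : ZMod k) * (x + y + z) = 0)).resolve_left h3
      linear_combination hsum
    have hφxyz : φ x * φ y * φ z = 1 := by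
      rw [← AddChar.map_add_eq_mul, ← AddChar.map_add_eq_mul, hxyz, AddChar.map_zero_eq_one]
    have hxy : x ≠ y := fun h => h12 (by rw [h])
    have hxz : x ≠ z := fun h => h13 (by rw [h])
    have hyz : y ≠ z := fun h => h23 (by rw [h])
    have hP : φ P ≠ 0 := (φ.val_isUnit P).ne_zero
    have hfac : φ P * ((φ x + φ y + φ z) *
        ((φ (x + x) + φ (y + y) + φ (z + z)) - (φ (y + z) + φ (x + z) + φ (x + y)))) = 0 := by
      simp only [AddChar.map_add_eq_mul] at h ⊢
      linear_combination (-1) * h - 3 * φ P * hφxyz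
    rcases mul_eq_zero.1 ((mul_eq_zero.1 hfac).resolve_left hP) with h1 | h1
    · exact hφ.not_sum_three_eq_zero hk3 hxy hxz hyz h1
    · have hxne {u v w : ZMod k} (huvw : u + v + w = 0)
          (hu : u + u = v + w) : u = 0 := by
        refine (mul_eq_zero.1 (?_ : (3 : ZMod k) * u = 0)).resolve_left h3
        linear_combination hu + huvw
      by_cases hall : x + x = y + y ∧ x + x = z + z
      · have e : (x - y) + (x - y) = 0 := by linear_combination hall.1
        have e' : (x - z) + (x - z) = 0 := by linear_combination hall.2
        by_cases h2 : (2 : ZMod k) = 0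
        · have hk2 : k = 2 := by
            have : ((2 : ℕ) : ZMod k) = 0 := by exact_mod_cast h2
            rwa [ZMod.natCast_eq_zero_iff, Nat.prime_dvd_prime_iff_eq hk Nat.prime_two] at this
          subst hk2
          exact ZMod.not_distinct_two x y z hxy hxz hyz
        · refine hxy (sub_eq_zero.1
            ((mul_eq_zero.1 (?_ : (2 : ZMod k) * (x - y) = 0)).resolve_left h2))
          linear_combination e
      · obtain ⟨a1, a2, -⟩ := hφ.mem_of_sum_three_eq (sub_eq_zero.1 h1) hall
          (fun h => hxy (by linear_combination (-1) * h))
          (fun h => hxz (by linear_combination (-1) * h))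
          (fun h => hyz (by linear_combination (-1) * h))
        have ax : x = 0 := by
          rcases a1 with a | a | a
          · exact hxne hxyz a
          · exact absurd (by linear_combination a) hxz
          · exact absurd (by linear_combination a) hxy
        have ay : y = 0 := by
          rcases a2 with a | a | a
          · exact absurd (by linear_combination a) hyz
          · exact hxne (by linear_combination hxyz) a
          · exact absurd (by linear_combination (-1) * a) hxy
        exact hxy (ax.trans ay.symm)

/-! ### Vanishing determinants -/

/-- The determinant vanishes with a coincidence on each side: normalized form. -/
theorem not_two_eq_two_eq_normalized (hφ : φ.IsRigid) {r s r₂ r₃ s₂ s₃ : ZMod k}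
    (hφi : Function.Injective φ)
    (hr12 : r ≠ r₂) (hr13 : r ≠ r₃) (hr23 : r₂ ≠ r₃) (hs12 : s ≠ s₂) (hs13 : s ≠ s₃)
    (h : φ (r₂ + s₃) + φ (r₃ + s) + φ (r + s₂) = φ (r₃ + s₂) + φ (r + s₃) + φ (r₂ + s))
    (hp : r₃ + s = r + s₂)
    (hm : r + s₃ = r₂ + s ∨ r₃ + s₂ = r + s₃ ∨ r₃ + s₂ = r₂ + s) : False := by
  obtain ⟨t, rfl⟩ : ∃ t, r₃ = r + t := ⟨r₃ - r, by ring⟩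
  obtain ⟨v, rfl⟩ : ∃ v, r₂ = r + v := ⟨r₂ - r, by ring⟩
  obtain ⟨w, rfl⟩ : ∃ w, s₃ = s + w := ⟨s₃ - s, by ring⟩
  obtain rfl : s₂ = s + t := by linear_combination -hp
  have ht : t ≠ 0 := by rintro rfl; simp at hr13
  have hv : v ≠ 0 := by rintro rfl; simp at hr12
  have hw : w ≠ 0 := by rintro rfl; simp at hs13
  have hvt : v ≠ t := fun h => hr23 (by rw [h])
  have hφt : φ t - 1 ≠ 0 := by
    rw [sub_ne_zero, ← φ.map_zero_eq_one]
    exact fun h => ht (hφi h)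
  have hφvt : φ v - φ t ≠ 0 := by
    rw [sub_ne_zero]
    exact fun h => hvt (hφi h)
  have hR : φ r * φ s ≠ 0 := mul_ne_zero (φ.val_isUnit _).ne_zero (φ.val_isUnit _).ne_zero
  -- Dividing by `φ r * φ s` leaves a relation in `t`, `v`, `w`. Each case of `hm` eliminates one
  -- variable and splits off a nonzero factor, `φ v - φ t` or `φ t - 1`, leaving a relation `2 φ a =
  -- φ b + φ c`.
  have h' : φ v * φ w + φ t + φ t = φ t * φ t + φ w + φ v := by
    simp only [AddChar.map_add_eq_mul] at h
    apply mul_left_cancel₀ hR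
    linear_combination h
  rcases hm with hm | hm | hm
  · obtain rfl : w = v := by linear_combination hm
    refine hφ.not_two_mul_eq_add (a := 0) (b := w) (c := t) ?_ hv.symm
    apply mul_left_cancel₀ hφvt
    rw [φ.map_zero_eq_one]
    linear_combination -h'
  · obtain rfl : w = t + t := by linear_combination -hm
    refine hφ.not_two_mul_eq_add (a := t) (b := v) (c := v + t) ?_ hvt.symm
    rw [φ.map_add_eq_mul] at h' ⊢
    apply mul_left_cancel₀ hφt
    linear_combination -h'
  · obtain rfl : v = t + t := by linear_combination -hm
    refine hφ.not_two_mul_eq_add (a := t) (c := w) (b := w + t) ?_ (fun h => hw ?_)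
    · rw [φ.map_add_eq_mul] at h' ⊢
      apply mul_left_cancel₀ hφt
      linear_combination -h'
    · linear_combination -h

/-- A vanishing determinant with a coincidence on each side. -/
theorem not_two_eq_two_eq (hφ : φ.IsRigid) (hφi : Function.Injective φ)
    {r₁ r₂ r₃ s₁ s₂ s₃ : ZMod k}
    (hr12 : r₁ ≠ r₂) (hr13 : r₁ ≠ r₃) (hr23 : r₂ ≠ r₃)
    (hs12 : s₁ ≠ s₂) (hs13 : s₁ ≠ s₃) (hs23 : s₂ ≠ s₃)
    (h : φ (r₂ + s₃) + φ (r₃ + s₁) + φ (r₁ + s₂) = φ (r₃ + s₂) + φ (r₁ + s₃) + φ (r₂ + s₁))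
    (hp : r₂ + s₃ = r₃ + s₁ ∨ r₂ + s₃ = r₁ + s₂ ∨ r₃ + s₁ = r₁ + s₂)
    (hm : r₃ + s₂ = r₁ + s₃ ∨ r₃ + s₂ = r₂ + s₁ ∨ r₁ + s₃ = r₂ + s₁) : False := by
  -- A cyclic permutation of the three rows moves the coincidence to the normalized position.
  rcases hp with hp | hp | hp
  · exact hφ.not_two_eq_two_eq_normalized hφi hr13.symm hr23.symm hr12 hs13.symm hs23.symm
      (by linear_combination h) hp (by tauto)
  · exact hφ.not_two_eq_two_eq_normalized hφi hr23 hr12.symm hr13.symm hs23 hs12.symm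
      (by linear_combination h) hp.symm (by tauto)
  · exact hφ.not_two_eq_two_eq_normalized hφi hr12 hr13 hr23 hs12 hs13 h hp (by tauto)

/-- The exponents of a vanishing `3 × 3` determinant with rows `(1, φ rᵢ, φ sᵢ)`. -/
theorem sub_eq_sub_of_det_eq_zero (hφ : φ.IsRigid) (hk : k.Prime) (hkF : (k : F) ≠ 0)
    (hφi : Function.Injective φ) {r₁ r₂ r₃ s₁ s₂ s₃ : ZMod k}
    (hr12 : r₁ ≠ r₂) (hr13 : r₁ ≠ r₃) (hr23 : r₂ ≠ r₃)
    (hs12 : s₁ ≠ s₂) (hs13 : s₁ ≠ s₃) (hs23 : s₂ ≠ s₃)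
    (h : φ (r₂ + s₃) + φ (r₃ + s₁) + φ (r₁ + s₂) = φ (r₃ + s₂) + φ (r₁ + s₃) + φ (r₂ + s₁)) :
    r₁ + s₂ = r₂ + s₁ := by
  by_cases hm : r₃ + s₂ = r₁ + s₃ ∨ r₃ + s₂ = r₂ + s₁ ∨ r₁ + s₃ = r₂ + s₁
  · by_cases hp : r₂ + s₃ = r₃ + s₁ ∨ r₂ + s₃ = r₁ + s₂ ∨ r₃ + s₁ = r₁ + s₂
    · exact (hφ.not_two_eq_two_eq hφi hr12 hr13 hr23 hs12 hs13 hs23 h hp hm).elim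
    · push Not at hp
      by_cases hall : r₃ + s₂ = r₁ + s₃ ∧ r₃ + s₂ = r₂ + s₁
      · refine (hφ.not_three_mul_eq hk hkF (P := r₃ + s₂) hp.1 hp.2.1 hp.2.2 ?_ ?_).elim
        · linear_combination -hall.1 - hall.2
        · rw [h, ← hall.1, ← hall.2]; ring
      · obtain ⟨-, -, h3 | h3 | h3⟩ := hφ.mem_of_sum_three_eq h.symm hall hp.1 hp.2.1 hp.2.2
        · exact absurd (by linear_combination h3) hs13
        · exact absurd (by linear_combination h3) hr23
        · exact h3.symm
  · push Not at hm
    by_cases hall : r₂ + s₃ = r₃ + s₁ ∧ r₂ + s₃ = r₁ + s₂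
    · refine (hφ.not_three_mul_eq hk hkF (P := r₂ + s₃) hm.1 hm.2.1 hm.2.2 ?_ ?_).elim
      · linear_combination -hall.1 - hall.2
      · rw [← h, ← hall.1, ← hall.2]; ring
    · obtain ⟨-, -, h3 | h3 | h3⟩ := hφ.mem_of_sum_three_eq h hall hm.1 hm.2.1 hm.2.2
      · exact absurd (by linear_combination h3) hr13
      · exact absurd (by linear_combination h3) hs23
      · exact h3

end AddChar.IsRigid

/-! ### The bound on cyclotomic numbers -/

theorem mainTheorem11 {F : Type*} [Field F] [Finite F]
    (p n q e k : ℕ) (hp : p.Prime) (hq : q = p ^ n) (hF : Nat.card F = q)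
    (hqek : q = e * k + 1) (hk : k.Prime)
    (g : Fˣ) (hg : ∀ x : Fˣ, x ∈ Subgroup.zpowers g)
    (a b : ℤ) (ha : a ∈ Set.Icc (1 : ℤ) ((e : ℤ) - 1)) (hb : b ∈ Set.Icc (1 : ℤ) ((e : ℤ) - 1))
    (hab : a ≠ b)
    (hbound : (p : ℝ) >
      ((3 : ℝ) ^ (k - 1) * (k : ℝ)) ^ (1 / (orderOf (p : ZMod k) : ℝ))) :
    cyclotomicNumber g e k a b ≤ 2 := by
  have : NeZero k := ⟨hk.ne_zero⟩
  have : Fact p.Prime := ⟨hp⟩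
  have : Fact k.Prime := ⟨hk⟩
  cases nonempty_fintype F
  have he : 0 < e := by have := ha.1.trans ha.2; omega
  have hn : n ≠ 0 := by
    rintro rfl
    have := Finite.one_lt_card (α := F)
    rw [hF, hq, pow_zero] at this
    exact this.false
  have hcharF : CharP F p := by
    obtain ⟨m, hm, hcard⟩ := FiniteField.card F (ringChar F)
    rw [← Nat.card_eq_fintype_card, hF, hq] at hcard
    have : p ∣ ringChar F := hp.dvd_of_dvd_pow (hcard ▸ dvd_pow_self p hn)
    rw [(Nat.prime_dvd_prime_iff_eq hp hm).1 this]
    exact ringChar.charP F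
  have hkp : ¬ p ∣ k := by
    intro h
    have h1 : p ∣ e * k + 1 := by rw [← hqek, hq]; exact dvd_pow_self p hn
    have h2 : p ∣ 1 := (Nat.dvd_add_right (h.mul_left e)).1 h1
    exact hp.one_lt.ne' (Nat.dvd_one.1 h2)
  have hkF : (k : F) ≠ 0 := fun h => hkp ((CharP.cast_eq_zero_iff F p k).1 h)
  have hord : 0 < orderOf (p : ZMod k) := by
    have h1 : (p : ZMod k) ≠ 0 := by
      rw [Ne, ZMod.natCast_eq_zero_iff, Nat.prime_dvd_prime_iff_eq hk hp]
      rintro rfl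
      exact hkp dvd_rfl
    have h2 : IsOfFinOrder (Units.mk0 (p : ZMod k) h1) := isOfFinOrder_of_finite _
    have h3 := h2.orderOf_pos
    rwa [← orderOf_units, Units.val_mk0] at h3
  have hbound' : 3 ^ (k - 1) * k < p ^ orderOf (p : ZMod k) := by
    have h1 := pow_lt_pow_left₀ hbound (by positivity) hord.ne'
    rw [one_div, Real.rpow_inv_natCast_pow (by positivity) hord.ne'] at h1
    exact_mod_cast h1
  have hgord : orderOf g = e * k := by
    rw [orderOf_eq_card_of_forall_mem_zpowers hg, Nat.card_units, hF, hqek, Nat.add_sub_cancel]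
  have hh : orderOf ((g ^ e : Fˣ) : F) = k := by
    rw [orderOf_units, orderOf_pow_of_dvd he.ne' (hgord ▸ dvd_mul_right e k), hgord,
      Nat.mul_div_cancel_left _ he]
  set h : F := ((g ^ e : Fˣ) : F) with hdef
  have hpow : h ^ k = 1 := by rw [← hh]; exact pow_orderOf_eq_one h
  let φ : AddChar (ZMod k) F := AddChar.zmodChar k hpow
  have hφ : φ.IsRigid := fun c hc h0 =>
    coeff_eq_of_sum_eq_zero_of_large_char hp hk hh hbound' c hc h0
  have hφi : Function.Injective φ := by
    intro u v huv
    have h1 : h ^ u.val = h ^ v.val := huv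
    exact ZMod.val_injective k
      ((hh ▸ IsPrimitiveRoot.orderOf h).pow_inj (ZMod.val_lt u) (ZMod.val_lt v) h1)
  have hclass {a : ℤ} {x : F} (hx : x ∈ cyclotomicClass g e k a) :
      ∃ u : ZMod k, x = ((g ^ a : Fˣ) : F) * φ u := by
    obtain ⟨r, hr, rfl⟩ := hx
    refine ⟨r, ?_⟩
    rw [AddChar.zmodChar_apply, ZMod.val_natCast_of_lt hr, hdef, ← Units.val_pow_eq_pow_val,
      ← Units.val_mul, ← pow_mul, zpow_add, mul_comm (r : ℤ), ← Nat.cast_mul, zpow_natCast]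
  rw [cyclotomicNumber]
  by_contra! hlt
  obtain ⟨⟨x₁, y₁⟩, ⟨x₂, y₂⟩, ⟨x₃, y₃⟩, h₁, h₂, h₃, h12, h13, h23⟩ :=
    (Set.two_lt_ncard_iff (Set.toFinite _)).1 hlt
  obtain ⟨hx₁, hy₁, e₁⟩ := h₁
  obtain ⟨hx₂, hy₂, e₂⟩ := h₂
  obtain ⟨hx₃, hy₃, e₃⟩ := h₃
  dsimp only at hx₁ hy₁ e₁ hx₂ hy₂ e₂ hx₃ hy₃ e₃
  obtain ⟨r₁, rfl⟩ := hclass hx₁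
  obtain ⟨r₂, rfl⟩ := hclass hx₂
  obtain ⟨r₃, rfl⟩ := hclass hx₃
  obtain ⟨s₁, rfl⟩ := hclass hy₁
  obtain ⟨s₂, rfl⟩ := hclass hy₂
  obtain ⟨s₃, rfl⟩ := hclass hy₃
  have hα : ((g ^ a : Fˣ) : F) ≠ 0 := Units.ne_zero _
  have hβ : ((g ^ b : Fˣ) : F) ≠ 0 := Units.ne_zero _
  generalize ((g ^ a : Fˣ) : F) = α at *
  generalize ((g ^ b : Fˣ) : F) = β at *
  -- Either coordinate of a solution determines the other, so distinct solutions differ in both.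
  have hr {r r' s s' : ZMod k} (e : 1 + α * φ r = β * φ s) (e' : 1 + α * φ r' = β * φ s')
      (hne : (α * φ r, β * φ s) ≠ (α * φ r', β * φ s')) : r ≠ r' ∧ s ≠ s' := by
    constructor <;> rintro rfl
    · exact hne (by rw [← e, ← e'])
    · have : α * φ r = α * φ r' := by linear_combination e - e'
      exact hne (by rw [this])
  obtain ⟨hr12, hs12⟩ := hr e₁ e₂ h12
  obtain ⟨hr13, hs13⟩ := hr e₁ e₃ h13
  obtain ⟨hr23, hs23⟩ := hr e₂ e₃ h23
  have hdet : φ (r₂ + s₃) + φ (r₃ + s₁) + φ (r₁ + s₂)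
      = φ (r₃ + s₂) + φ (r₁ + s₃) + φ (r₂ + s₁) := by
    simp only [AddChar.map_add_eq_mul]
    apply mul_left_cancel₀ hα
    -- These multipliers sum to zero and are orthogonal to `(φ s₁, φ s₂, φ s₃)`, so the constants
    -- and `β` drop out.
    linear_combination (φ s₂ - φ s₃) * e₁ + (φ s₃ - φ s₁) * e₂ + (φ s₁ - φ s₂) * e₃
  have hrs := congrArg φ
    (hφ.sub_eq_sub_of_det_eq_zero hk hkF hφi hr12 hr13 hr23 hs12 hs13 hs23 hdet)
  simp only [AddChar.map_add_eq_mul] at hrs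
  refine hr12 (hφi (mul_left_cancel₀ hα ?_))
  -- Replacing `β φ(sᵢ)` by `1 + α φ(rᵢ)` in `hrs` cancels the products `φ r₁ * φ r₂`.
  linear_combination α * β * hrs + α * φ r₁ * e₂ - α * φ r₂ * e₁
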